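/- Let $X$ be a Hausdorff topological space, let $CL(X)$ be the set of all nonempty closed subsets of $X$, and equip $CL(X)$ with the locally finite topology $\tau_{locfin}$, that is, the topology that has as a subbase all sets $V^{+}=\{A\in CL(X): A\subseteq V\}$ with $V$ open in $X$ and all sets $\mathcal{U}^{-}=\{A\in CL(X): A\cap U\neq\emptyset \text{ for every } U\in\mathcal{U}\}$ with $\mathcal{U}$ a locally finite family of open subsets of $X$. Let $NI(X)$ be the set of all non-isolated points of $X$. Then the following statements are equivalent: 1. $(CL(X),\tau_{locfin})$ is metrizable; 2. $(CL(X),\tau_{locfin})$ has a point-countable base, i.e. a base such that every point lies in at most countably many of its members; 3. $(CL(X),\tau_{locfin})$ is quasi-metrizable, i.e. there is a function $d: CL(X)\times CL(X)\to[0,\infty)$ with $d(A,B)=0$ if and only if $A=B$, and $d(A,C)\le d(A,B)+d(B,C)$ for all $A,B,C$, such that the sets $\{B: d(A,B)<\varepsilon\}$ with $A\in CL(X)$ and $\varepsilon>0$ form a base for $\tau_{locfin}$; 4. every closed countably compact subset $\mathcal{C}$ of $(CL(X),\tau_{locfin})$ has a countable base in $(CL(X),\tau_{locfin})$, i.e.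 there is a countable family of open sets containing $\mathcal{C}$ such that every open set containing $\mathcal{C}$ contains a member of the family; 5. $X$ is metrizable and $NI(X)$ is compact. -/

import Mathlib

open Set TopologicalSpace

/-- The hyperspace `CL(X)`: the set of all nonempty closed subsets of `X`. -/
def CL (X : Type*) [TopologicalSpace X] : Type _ :=
  {A : Set X // A.Nonempty ∧ IsClosed A}

namespace CL

variable {X : Type*} [TopologicalSpace X]

/-- `V⁺`: the nonempty closed sets that are contained in `V`. -/
def plus (V : Set X) : Set (CL X) :=
  {A | A.1 ⊆ V}

/-- `𝒰⁻`: the nonempty closed sets that meet every member of the family `𝒰`. -/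
def minus (𝒰 : Set (Set X)) : Set (CL X) :=
  {A | ∀ U ∈ 𝒰, (A.1 ∩ U).Nonempty}

/-- The locally finite topology on `CL(X)`: it has as a subbase the sets `V⁺`, for `V` open in `X`,
and the sets `𝒰⁻`, for `𝒰` a locally finite family of open subsets of `X`. -/
instance locallyFiniteTopology : TopologicalSpace (CL X) :=
  TopologicalSpace.generateFrom
    ({S | ∃ V : Set X, IsOpen V ∧ S = plus V} ∪
      {S | ∃ 𝒰 : Set (Set X), (∀ U ∈ 𝒰, IsOpen U) ∧
        LocallyFinite (fun U : 𝒰 => (U : Set X)) ∧ S = minus 𝒰})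

end CL

/-- A quasi-metric: a nonnegative function with `d x y = 0 ↔ x = y` and the triangle inequality,
not necessarily symmetric. -/
structure IsQuasiMetric {Y : Type*} (d : Y → Y → ℝ) : Prop where
  nonneg : ∀ x y, 0 ≤ d x y
  eq_zero_iff : ∀ x y, d x y = 0 ↔ x = y
  triangle : ∀ x y z, d x z ≤ d x y + d y z

/-- A space is quasi-metrizable if there is a quasi-metric whose `ε`-neighbourhoods
`{y | d x y < ε}` form a base for the topology. -/
def QuasiMetrizable (Y : Type*) [TopologicalSpace Y] : Prop :=
  ∃ d : Y → Y → ℝ, IsQuasiMetric d ∧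
    IsTopologicalBasis {B : Set Y | ∃ (x : Y) (ε : ℝ), 0 < ε ∧ B = {y | d x y < ε}}

/-- A space has a point-countable base if it has a base such that every point lies in at most
countably many members of the base. -/
def HasPointCountableBase (Y : Type*) [TopologicalSpace Y] : Prop :=
  ∃ ℬ : Set (Set Y), IsTopologicalBasis ℬ ∧ ∀ y : Y, {B ∈ ℬ | y ∈ B}.Countable

/-- A subset `S` of a space has a countable (local) base: there are countably many open sets
containing `S` such that every open set containing `S` contains one of them. -/
def HasCountableBaseAt {Y : Type*} [TopologicalSpace Y] (S : Set Y) : Prop :=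
  ∃ ℬ : Set (Set Y), ℬ.Countable ∧ (∀ B ∈ ℬ, IsOpen B ∧ S ⊆ B) ∧
    ∀ U : Set Y, IsOpen U → S ⊆ U → ∃ B ∈ ℬ, B ⊆ U

/-- `NI(X)`: the set of non-isolated points of `X`. -/
def nonIsolatedPoints (X : Type*) [TopologicalSpace X] : Set X :=
  {x | ¬ IsOpen ({x} : Set X)}

/-!
The implications between the five conditions run as follows.

*From a metric to the countability conditions.* A metrizable space has a point-countable base because
the covers by balls of radius `1 / (n + 1)` have locally finite refinements, and it is trivially
quasi-metrizable. Each of these two properties gives every countably compact set a countable base of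
neighbourhoods: for a point-countable base, a countably compact set is covered by finitely many base
members inside any given neighbourhood, and Miščenko's lemma says that there are only countably many
minimal finite covers; for a quasi-metric, the unions of balls of radius `1 / (n + 1)` do.

*From countable bases in the hyperspace to the base space.* Let every closed countably compact set
of `CL X` have a countable base. Then `CL X` is first countable, and since `x ↦ A ∪ {x}` is a
continuous map `X → CL X`, every closed `A ⊆ X` has a countably generated neighbourhood filter. The
basic tool is then `exists_mapClusterPt_of_tendsto_nhdsSet`: a sequence outside `A` that converges to
`𝓝ˢ A` clusters at a point of `A`. It makes disjoint closed sets of `X` separated, and makes the set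
`K` of non-isolated points countably compact. Hence the set `F` of singletons `{x}`, `x ∈ K`, is
closed and countably compact in `CL X`, so `𝓝ˢ F` is countably generated. Pulled back along
`(x, y) ↦ {x, y}` and joined with the diagonal, `𝓝ˢ F` is a countably generated uniformity that
induces the topology of `X`: the composition axiom is the cluster point lemma again, now applied in
`CL X` to `F`. So `X` is metrizable, and `K`, being countably compact, is compact.

*From the base space to a metric on the hyperspace.* If `X` is metrizable and `K` is compact, then
with `ρ x` the distance from `x` to `K`, the formula `max (d x y) (max (ρ x) (ρ y))` for `x ≠ y`
defines a compatible distance for which points at distance less than `η` from another point lie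
`η`-close to `K`. For such a distance the Hausdorff distance induces the locally finite topology:
near `K` compactness gives uniform estimates, and away from `K` sets at small Hausdorff distance
agree.
-/

open Filter Topology
open scoped ENNReal

/-! ### Neighbourhood filters of sets and escaping sequences -/

theorem HasCountableBaseAt.isCountablyGenerated {Y : Type*} [TopologicalSpace Y] {S : Set Y}
    (h : HasCountableBaseAt S) : (𝓝ˢ S).IsCountablyGenerated := by
  obtain ⟨ℬ, hℬ, hopen, hsub⟩ := h
  refine ⟨ℬ, hℬ, le_antisymm ?_ fun U hU => ?_⟩
  · rw [Filter.le_generate_iff]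
    exact fun B hB => (hopen B hB).1.mem_nhdsSet.2 (hopen B hB).2
  · obtain ⟨V, hV, hSV, hVU⟩ := mem_nhdsSet_iff_exists.1 hU
    obtain ⟨B, hB, hBV⟩ := hsub V hV hSV
    exact mem_of_superset (Filter.mem_generate_of_mem hB) (hBV.trans hVU)

/-- A sequence outside `A` that converges to `A` clusters at a point of `A`: otherwise each point of
`A` has a neighbourhood that misses the whole sequence, and so has `A`. -/
theorem exists_mapClusterPt_of_tendsto_nhdsSet {Y : Type*} [TopologicalSpace Y] [T1Space Y]
    {A : Set Y} {y : ℕ → Y} (hy : Tendsto y atTop (𝓝ˢ A)) (hyA : ∀ n, y n ∉ A) :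
    ∃ z ∈ A, MapClusterPt z atTop y := by
  by_contra! hno
  have key : (range y)ᶜ ∈ 𝓝ˢ A := by
    rw [mem_nhdsSet_iff_forall]
    intro z hz
    have h := hno z hz
    simp only [mapClusterPt_iff_frequently, not_forall, not_frequently] at h
    obtain ⟨O, hO, hyO⟩ := h
    obtain ⟨N, hN⟩ := eventually_atTop.1 hyO
    have hfin : (y '' Iio N).Finite := (finite_Iio N).image y
    have hz' : z ∉ y '' Iio N := by
      rintro ⟨n, -, rfl⟩
      exact hyA n hz
    filter_upwards [hO, hfin.isClosed.compl_mem_nhds hz'] with w hwO hwN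
    rintro ⟨n, rfl⟩
    rcases lt_or_ge n N with h | h
    · exact hwN ⟨n, h, rfl⟩
    · exact hN n h hwO
  obtain ⟨n, hn⟩ := (hy.eventually_mem key).exists
  exact hn ⟨n, rfl⟩

theorem exists_subseq_tendsto_of_tendsto_nhdsSet {Y : Type*} [TopologicalSpace Y] [T1Space Y]
    [FirstCountableTopology Y] {A : Set Y} {y : ℕ → Y} (hy : Tendsto y atTop (𝓝ˢ A))
    (hyA : ∀ n, y n ∉ A) :
    ∃ z ∈ A, ∃ φ : ℕ → ℕ, StrictMono φ ∧ Tendsto (y ∘ φ) atTop (𝓝 z) := by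
  obtain ⟨z, hz, hc⟩ := exists_mapClusterPt_of_tendsto_nhdsSet hy hyA
  exact ⟨z, hz, hc.tendsto_subseq⟩

/-! ### Spaces whose closed sets have countable character -/

section ClosedCharacter

variable {X : Type*} [TopologicalSpace X] [T2Space X]

theorem firstCountableTopology_of_closed
    (h : ∀ A : Set X, IsClosed A → (𝓝ˢ A).IsCountablyGenerated) :
    FirstCountableTopology X :=
  ⟨fun x => by simpa only [nhdsSet_singleton] using h {x} isClosed_singleton⟩

/-- If all closed sets of a Hausdorff space have countable character, disjoint closed sets are
separated: a sequence that converges to both of them, but lies in neither, would have limits of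
subsequences in both. -/
theorem disjoint_nhdsSet_of_closed
    (h : ∀ A : Set X, IsClosed A → (𝓝ˢ A).IsCountablyGenerated)
    {A B : Set X} (hA : IsClosed A) (hB : IsClosed B) (hAB : Disjoint A B) :
    Disjoint (𝓝ˢ A) (𝓝ˢ B) := by
  have := firstCountableTopology_of_closed h
  have := h A hA
  have := h B hB
  rw [disjoint_iff]
  by_contra hne
  have : (𝓝ˢ A ⊓ 𝓝ˢ B).NeBot := ⟨hne⟩
  have hBA : Bᶜ ∈ 𝓝ˢ A := hB.isOpen_compl.mem_nhdsSet.2 hAB.subset_compl_right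
  have hAB' : Aᶜ ∈ 𝓝ˢ B := hA.isOpen_compl.mem_nhdsSet.2 hAB.subset_compl_left
  have hmem : ∀ᶠ x in 𝓝ˢ A ⊓ 𝓝ˢ B, x ∉ A ∧ x ∉ B := by
    filter_upwards [mem_inf_of_left hBA, mem_inf_of_right hAB'] with x h1 h2 using ⟨h2, h1⟩
  obtain ⟨y, hy, hyn⟩ : ∃ y : ℕ → X, Tendsto y atTop (𝓝ˢ A ⊓ 𝓝ˢ B) ∧ ∀ n, y n ∉ A ∧ y n ∉ B :=
    exists_seq_forall_of_frequently hmem.frequently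
  obtain ⟨z, hz, φ, hφ, hφz⟩ := exists_subseq_tendsto_of_tendsto_nhdsSet
    (hy.mono_right inf_le_left) fun n => (hyn n).1
  obtain ⟨w, hw, ψ, hψ, hψw⟩ := exists_subseq_tendsto_of_tendsto_nhdsSet
    ((hy.mono_right inf_le_right).comp hφ.tendsto_atTop) fun n => (hyn (φ n)).2
  have hzw : z = w := tendsto_nhds_unique (hφz.comp hψ.tendsto_atTop) hψw
  exact hAB.notMem_of_mem_left hz (hzw ▸ hw)

theorem isClosed_nonIsolatedPoints (X : Type*) [TopologicalSpace X] :
    IsClosed (nonIsolatedPoints X) := by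
  rw [← isOpen_compl_iff, isOpen_iff_mem_nhds]
  intro x hx
  have hx' : IsOpen ({x} : Set X) := by simpa [nonIsolatedPoints] using hx
  exact mem_of_superset (hx'.mem_nhds rfl) (singleton_subset_iff.2 hx)

/-- If all closed sets of a Hausdorff space have countable character, the non-isolated points form a
countably compact set: given a closed discrete sequence `x` of non-isolated points, one moves each
`x n` slightly to a point `y n` outside `range x`, so that `y` converges to `range x` but clusters
at none of its points. -/
theorem isCountablyCompact_nonIsolatedPoints
    (h : ∀ A : Set X, IsClosed A → (𝓝ˢ A).IsCountablyGenerated) :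
    IsCountablyCompact (nonIsolatedPoints X) := by
  have := firstCountableTopology_of_closed h
  rw [isCountablyCompact_iff_infinite_subset_has_accPt]
  intro B hBK hB
  by_contra! hno'
  -- no subset of `B` has an accumulation point, so every subset of `B` is closed
  have hclosed : ∀ S ⊆ B, IsClosed S := by
    intro S hSB
    rw [isClosed_iff_derivedSet_subset]
    intro z hz
    have hzB : AccPt z (𝓟 B) := AccPt.mono hz (principal_mono.2 hSB)
    have hzK : z ∈ nonIsolatedPoints X :=
      closure_minimal hBK (isClosed_nonIsolatedPoints X)
        (mem_closure_iff_clusterPt.2 hzB.clusterPt)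
    exact absurd hzB (hno' z hzK)
  set x : ℕ → X := fun n => hB.natEmbedding B n
  have hxinj : Function.Injective x := Subtype.val_injective.comp (hB.natEmbedding B).injective
  have hxB : ∀ n, x n ∈ B := fun n => (hB.natEmbedding B n).2
  have hF : IsClosed (range x) := hclosed _ (range_subset_iff.2 hxB)
  have hxF : ∀ n, IsClosed (range x \ {x n}) := fun n =>
    hclosed _ (sdiff_subset.trans (range_subset_iff.2 hxB))
  have hsep : ∀ n, ∃ P ∈ 𝓝 (x n), ∃ Q ∈ 𝓝ˢ (range x \ {x n}), Disjoint P Q := fun n => by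
    have := disjoint_nhdsSet_of_closed h isClosed_singleton (hxF n) disjoint_sdiff_right
    rwa [nhdsSet_singleton, Filter.disjoint_iff] at this
  choose P hP Q hQ hPQ using hsep
  have := h _ hF
  obtain ⟨V, hV⟩ := (𝓝ˢ (range x)).exists_antitone_basis
  -- `Q m` keeps `y n` away from `x m` for `m < n`
  have hchoice : ∀ n, ∃ y, y ∈ V n ∧ y ∉ range x ∧ ∀ m < n, y ∈ Q m := by
    intro n
    have : (𝓝[≠] x n).NeBot := by
      have := hBK (hxB n)
      rwa [nonIsolatedPoints, mem_ofPred_eq, isOpen_singleton_iff_punctured_nhds, ← ne_eq,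
        ← neBot_iff] at this
    have h1 : ∀ᶠ y in 𝓝[≠] x n, y ∈ V n :=
      nhdsWithin_le_nhds (nhds_le_nhdsSet (mem_range_self n) (hV.1.mem_of_mem trivial))
    have h2 : ∀ᶠ y in 𝓝[≠] x n, y ∉ range x \ {x n} :=
      nhdsWithin_le_nhds ((hxF n).isOpen_compl.mem_nhds (by simp))
    have h3 : ∀ᶠ y in 𝓝[≠] x n, ∀ m ∈ Iio n, y ∈ Q m :=
      (eventually_all_finite (finite_Iio n)).2 fun m hm => nhdsWithin_le_nhds
        (nhds_le_nhdsSet (show x n ∈ range x \ {x m} from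
          ⟨mem_range_self n, fun e => (hm : m < n).ne' (hxinj e)⟩) (hQ m))
    obtain ⟨y, hy1, hy2, hy3, hy4⟩ := (h1.and (h2.and (h3.and self_mem_nhdsWithin))).exists
    exact ⟨y, hy1, fun hy => hy2 ⟨hy, hy4⟩, hy3⟩
  choose y hyV hyF hyQ using hchoice
  obtain ⟨z, ⟨m, rfl⟩, hz⟩ := exists_mapClusterPt_of_tendsto_nhdsSet (hV.tendsto hyV) hyF
  obtain ⟨n, hnP, hn⟩ := ((hz.frequently (hP m)).and_eventually (eventually_gt_atTop m)).exists
  exact (hPQ m).notMem_of_mem_left hnP (hyQ n m hn)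

end ClosedCharacter

/-! ### Continuous maps into the hyperspace -/

namespace CL

section Basic

variable {X : Type*} [TopologicalSpace X]

theorem isOpen_plus {V : Set X} (hV : IsOpen V) : IsOpen (plus V) :=
  isOpen_generateFrom_of_mem (Or.inl ⟨V, hV, rfl⟩)

theorem isOpen_minus {𝒰 : Set (Set X)} (hU : ∀ U ∈ 𝒰, IsOpen U)
    (hlf : LocallyFinite (fun U : 𝒰 => (U : Set X))) : IsOpen (minus 𝒰) :=
  isOpen_generateFrom_of_mem (Or.inr ⟨𝒰, hU, hlf, rfl⟩)

theorem isOpen_setOf_inter_nonempty {U : Set X} (hU : IsOpen U) :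
    IsOpen {A : CL X | (A.1 ∩ U).Nonempty} := by
  have : {A : CL X | (A.1 ∩ U).Nonempty} = minus {U} := by simp [minus]
  rw [this]
  exact isOpen_minus (by simpa using hU) (locallyFinite_of_finite _)

/-- Continuity into the hyperspace is tested on the subbase. -/
theorem continuous_iff {Z : Type*} [TopologicalSpace Z] {f : Z → CL X} :
    Continuous f ↔ (∀ V : Set X, IsOpen V → IsOpen {z | (f z).1 ⊆ V}) ∧
      ∀ 𝒰 : Set (Set X), (∀ U ∈ 𝒰, IsOpen U) → LocallyFinite (fun U : 𝒰 => (U : Set X)) →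
        IsOpen {z | ∀ U ∈ 𝒰, ((f z).1 ∩ U).Nonempty} := by
  rw [continuous_generateFrom_iff]
  constructor
  · exact fun h => ⟨fun V hV => h _ (Or.inl ⟨V, hV, rfl⟩),
      fun 𝒰 h1 h2 => h _ (Or.inr ⟨𝒰, h1, h2, rfl⟩)⟩
  · rintro ⟨h1, h2⟩ S (⟨V, hV, rfl⟩ | ⟨𝒰, hU, hlf, rfl⟩)
    · exact h1 V hV
    · exact h2 𝒰 hU hlf

/-- The union of two nonempty closed sets, as a point of the hyperspace. -/
def union (A B : CL X) : CL X :=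
  ⟨A.1 ∪ B.1, A.2.1.inl, A.2.2.union B.2.2⟩

theorem continuous_union : Continuous fun p : CL X × CL X => union p.1 p.2 := by
  refine continuous_iff.2 ⟨fun V hV => ?_, fun 𝒰 hU hlf => isOpen_iff_mem_nhds.2 ?_⟩
  · simpa only [union, union_subset_iff] using! (isOpen_plus hV).prod (isOpen_plus hV)
  · rintro ⟨A, B⟩ hAB
    -- the members of `𝒰` that meet `A`, and those that meet `B`, are again locally finite
    have hopen : ∀ C : CL X, minus {U ∈ 𝒰 | (C.1 ∩ U).Nonempty} ∈ 𝓝 C := fun C => by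
      refine (isOpen_minus ?_ ?_).mem_nhds ?_
      · rintro U ⟨hU𝒰, -⟩
        exact hU U hU𝒰
      · exact hlf.comp_injective (inclusion_injective (sep_subset _ _))
      · rintro U ⟨-, hCU⟩
        exact hCU
    filter_upwards [prod_mem_nhds (hopen A) (hopen B)]
    rintro ⟨A', B'⟩ ⟨hA', hB'⟩ U hUU
    have := hAB U hUU
    simp only [union, union_inter_distrib_right, union_nonempty] at this ⊢
    exact this.imp (fun h => hA' U ⟨hUU, h⟩) (fun h => hB' U ⟨hUU, h⟩)

instance [T1Space X] : T1Space (CL X) := by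
  refine ⟨fun A => isOpen_compl_iff.1 (isOpen_iff_mem_nhds.2 fun B (hB : B ≠ A) => ?_)⟩
  by_cases h : B.1 ⊆ A.1
  · have : ¬ A.1 ⊆ B.1 := fun h' => hB (Subtype.ext (h.antisymm h'))
    obtain ⟨a, ha, haB⟩ := not_subset.1 this
    filter_upwards [(isOpen_plus isOpen_compl_singleton).mem_nhds
      (show B ∈ plus {a}ᶜ from subset_compl_singleton_iff.2 haB)]
    rintro C hC rfl
    exact hC ha rfl
  · obtain ⟨b, hb, hbA⟩ := not_subset.1 h
    filter_upwards [(isOpen_setOf_inter_nonempty A.2.2.isOpen_compl).mem_nhds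
      (show B ∈ {A' : CL X | (A'.1 ∩ A.1ᶜ).Nonempty} from ⟨b, hb, hbA⟩)]
    rintro C ⟨c, hc, hcA⟩ rfl
    exact hcA hc

end Basic

section Single

variable {X : Type*} [TopologicalSpace X] [T1Space X]

/-- The point `{x}` of the hyperspace. -/
def single (x : X) : CL X :=
  ⟨{x}, singleton_nonempty x, isClosed_singleton⟩

theorem continuous_single : Continuous (single : X → CL X) := by
  refine continuous_iff.2 ⟨fun V hV => by simpa [single] using hV,
    fun 𝒰 hU hlf => isOpen_iff_mem_nhds.2 fun x hx => ?_⟩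
  have hfin : {U : 𝒰 | x ∈ (U : Set X)}.Finite := hlf.point_finite x
  -- all members of `𝒰` contain `x`, so `𝒰` is finite
  have : Finite 𝒰 := by
    rw [← Set.finite_univ_iff]
    refine hfin.subset fun U _ => ?_
    simpa [single] using hx U U.2
  have hfin' : 𝒰.Finite := this
  have := (biInter_mem hfin' (f := 𝓝 x) (s := id)).2 fun U hUU =>
    (hU U hUU).mem_nhds (by simpa [single] using hx U hUU)
  filter_upwards [this] with z hz U hUU
  simpa [single] using mem_iInter₂.1 hz U hUU

theorem continuous_union_single : Continuous fun p : X × X => union (single p.1) (single p.2) :=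
  continuous_union.comp (continuous_single.prodMap continuous_single)

@[simp] theorem union_single_self (x : X) : union (single x) (single x) = single x :=
  Subtype.ext (union_self _)

theorem union_single_comm (x y : X) :
    union (single x) (single y) = union (single y) (single x) :=
  Subtype.ext (union_comm _ _)

theorem union_single_mem_image_single {K : Set X} {x y : X} :
    union (single x) (single y) ∈ single '' K ↔ x = y ∧ x ∈ K := by
  constructor
  · rintro ⟨k, hk, h⟩
    have h' : {k} = ({x} ∪ {y} : Set X) := congrArg Subtype.val h
    have hx : x ∈ ({k} : Set X) := h' ▸ Or.inl rfl
    have hy : y ∈ ({k} : Set X) := h' ▸ Or.inr rfl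
    rw [mem_singleton_iff] at hx hy
    exact ⟨hx.trans hy.symm, hx ▸ hk⟩
  · rintro ⟨rfl, hx⟩
    exact ⟨x, hx, by simp⟩

theorem tendsto_of_tendsto_union_single {ι : Type*} {l : Filter ι} {a b : ι → X} {p : X}
    (h : Tendsto (fun i => union (single (a i)) (single (b i))) l (𝓝 (single p))) :
    Tendsto a l (𝓝 p) ∧ Tendsto b l (𝓝 p) := by
  have key : ∀ V : Set X, IsOpen V → p ∈ V → ∀ᶠ i in l, a i ∈ V ∧ b i ∈ V := fun V hV hp => by
    filter_upwards [h ((isOpen_plus hV).mem_nhds (singleton_subset_iff.2 hp))] with i hi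
    exact ⟨hi (Or.inl rfl), hi (Or.inr rfl)⟩
  exact ⟨tendsto_nhds.2 fun V hV hp => (key V hV hp).mono fun _ => And.left,
    tendsto_nhds.2 fun V hV hp => (key V hV hp).mono fun _ => And.right⟩

end Single

variable {X : Type*} [TopologicalSpace X] [T2Space X]

theorem isClosed_image_single {K : Set X} (hK : IsClosed K) : IsClosed (single '' K) := by
  rw [← isOpen_compl_iff, isOpen_iff_mem_nhds]
  intro A hA
  by_cases hAK : A.1 ⊆ K
  · -- `A` has two points, and sets meeting disjoint neighbourhoods of them are not singletons
    obtain ⟨x, hx⟩ := A.2.1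
    obtain ⟨y, hy, hxy⟩ : ∃ y ∈ A.1, x ≠ y := by
      by_contra! h
      exact hA ⟨x, hAK hx, Subtype.ext (Subset.antisymm (singleton_subset_iff.2 hx)
        fun y hy => (h y hy).symm)⟩
    obtain ⟨U, V, hU, hV, hxU, hyV, hUV⟩ := t2_separation hxy
    filter_upwards [(isOpen_setOf_inter_nonempty hU).mem_nhds ⟨x, hx, hxU⟩,
      (isOpen_setOf_inter_nonempty hV).mem_nhds ⟨y, hy, hyV⟩]
    rintro _ ⟨a, ha, haU⟩ ⟨b, hb, hbV⟩ ⟨k, -, rfl⟩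
    obtain rfl : a = k := ha
    obtain rfl : b = a := hb
    exact hUV.notMem_of_mem_left haU hbV
  · obtain ⟨a, ha, haK⟩ := not_subset.1 hAK
    filter_upwards [(isOpen_setOf_inter_nonempty hK.isOpen_compl).mem_nhds ⟨a, ha, haK⟩]
    rintro _ ⟨b, hb, hbK⟩ ⟨k, hk, rfl⟩
    obtain rfl : b = k := hb
    exact hbK hk

/-- For nonempty closed `A`, the filter `𝓝ˢ A` is the preimage of the neighbourhood filter of the
point `A` of the hyperspace under `x ↦ A ∪ {x}`. -/
theorem isCountablyGenerated_nhdsSet_of_isClosed [FirstCountableTopology (CL X)] {A : Set X}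
    (hA : IsClosed A) : (𝓝ˢ A).IsCountablyGenerated := by
  rcases A.eq_empty_or_nonempty with rfl | hne
  · rw [nhdsSet_empty]; infer_instance
  set a : CL X := ⟨A, hne, hA⟩
  have hcont : Continuous fun x => union a (single x) :=
    continuous_union.comp (continuous_const.prodMk continuous_single)
  have hmem : ∀ x ∈ A, union a (single x) = a := fun x hx =>
    Subtype.ext (union_eq_left.2 (singleton_subset_iff.2 hx))
  have : 𝓝ˢ A = comap (fun x => union a (single x)) (𝓝 a) := by
    refine le_antisymm ?_ fun U hU => ?_
    · rw [← tendsto_iff_comap, nhdsSet, tendsto_def]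
      intro S hS
      refine mem_sSup.2 ?_
      rintro _ ⟨x, hx, rfl⟩
      exact hcont.continuousAt (by rwa [hmem x hx])
    · obtain ⟨V, hV, hAV, hVU⟩ := mem_nhdsSet_iff_exists.1 hU
      refine ⟨plus V, (isOpen_plus hV).mem_nhds hAV, fun x hx => hVU (hx (Or.inr rfl))⟩
  rw [this]
  infer_instance

/-! ### Metrizability of the base space -/

/-- If the set `F` of singletons of non-isolated points has countable character in a first countable
hyperspace, then `X` is metrizable. The entourages are the sets that contain the diagonal and the
preimage of a neighbourhood of `F` under `(x, y) ↦ {x, y}`. -/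
theorem metrizableSpace_of_isCountablyGenerated [FirstCountableTopology (CL X)]
    (h : (𝓝ˢ (single '' nonIsolatedPoints X)).IsCountablyGenerated) : MetrizableSpace X := by
  set pair : X × X → CL X := fun p => union (single p.1) (single p.2) with hpair
  set K := nonIsolatedPoints X with hK
  set 𝒲 : Filter (X × X) := comap pair (𝓝ˢ (single '' K)) ⊔ 𝓟 SetRel.id with h𝒲
  have hmem : ∀ {U : Set (X × X)}, U ∈ 𝒲 ↔
      (∃ W ∈ 𝓝ˢ (single '' K), pair ⁻¹' W ⊆ U) ∧ ∀ x, (x, x) ∈ U := by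
    intro U
    rw [h𝒲, mem_sup, mem_comap, mem_principal]
    refine and_congr_right fun _ => ⟨fun h x => h rfl, ?_⟩
    rintro h ⟨x, y⟩ (rfl : x = y)
    exact h x
  have hsymm : Tendsto Prod.swap 𝒲 𝒲 := by
    intro U hU
    obtain ⟨⟨W, hW, hWU⟩, hd⟩ := hmem.1 hU
    refine hmem.2 ⟨⟨W, hW, fun p hp => hWU ?_⟩, fun x => hd x⟩
    change union (single p.2) (single p.1) ∈ W
    rwa [union_single_comm]
  -- if `(x n, y n)` and `(y n, z n)` converge to the uniformity off the diagonal, then along a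
  -- subsequence `{x n, y n}` and `{y n, z n}` converge to singletons, necessarily the same
  have hcomp : (𝒲.lift' fun s => SetRel.comp s s) ≤ 𝒲 := by
    intro U hU
    rw [mem_lift'_sets (fun s t hst => SetRel.comp_subset_comp hst hst)]
    by_contra! hno
    obtain ⟨O, hO⟩ := 𝒲.exists_antitone_basis
    have hsub : ∀ n, ∃ x y z, (x, y) ∈ O n ∩ U ∧ (y, z) ∈ O n ∩ U ∧ (x, z) ∉ U := fun n => by
      obtain ⟨⟨x, z⟩, ⟨y, hxy, hyz⟩, hxz⟩ :=
        not_subset.1 (hno _ (inter_mem (hO.1.mem_of_mem (i := n) trivial) hU))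
      exact ⟨x, y, z, hxy, hyz, hxz⟩
    choose x y z hxy hyz hxz using hsub
    have hxy_ne : ∀ n, x n ≠ y n := fun n e => hxz n (e ▸ (hyz n).2)
    have hyz_ne : ∀ n, y n ≠ z n := fun n e => hxz n (e ▸ (hxy n).2)
    -- off the diagonal, convergence to the uniformity is convergence of `{a n, b n}` to singletons
    have key : ∀ a b : ℕ → X, (∀ n, (a n, b n) ∈ O n) → (∀ n, a n ≠ b n) →
        Tendsto (fun n => pair (a n, b n)) atTop (𝓝ˢ (single '' K)) := by
      intro a b hab hne W hW
      have hW' : pair ⁻¹' W ∪ SetRel.id ∈ 𝒲 :=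
        hmem.2 ⟨⟨W, hW, subset_union_left⟩, fun x => Or.inr rfl⟩
      exact ((hO.tendsto hab).eventually_mem hW').mono fun n hn => hn.resolve_right (hne n)
    obtain ⟨_, ⟨p, hp, rfl⟩, φ, hφ, hφp⟩ := exists_subseq_tendsto_of_tendsto_nhdsSet
      (key x y (fun n => (hxy n).1) hxy_ne)
      fun n hn => hxy_ne n (union_single_mem_image_single.1 hn).1
    obtain ⟨_, ⟨q, hq, rfl⟩, ψ, hψ, hψq⟩ := exists_subseq_tendsto_of_tendsto_nhdsSet
      ((key y z (fun n => (hyz n).1) hyz_ne).comp hφ.tendsto_atTop)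
      fun n hn => hyz_ne _ (union_single_mem_image_single.1 hn).1
    obtain ⟨hxp, hyp⟩ := tendsto_of_tendsto_union_single hφp
    obtain ⟨hyq, hzq⟩ := tendsto_of_tendsto_union_single hψq
    obtain rfl : p = q := tendsto_nhds_unique (hyp.comp hψ.tendsto_atTop) hyq
    obtain ⟨⟨W, hW, hWU⟩, -⟩ := hmem.1 hU
    have hlim : Tendsto (fun n => pair (x (φ (ψ n)), z (φ (ψ n)))) atTop (𝓝 (pair (p, p))) :=
      (continuous_union_single.tendsto (p, p)).comp
        ((hxp.comp hψ.tendsto_atTop).prodMk_nhds hzq)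
    have hWp : W ∈ 𝓝 (pair (p, p)) := by
      simp only [hpair, union_single_self]
      exact nhds_le_nhdsSet (mem_image_of_mem _ hp) hW
    obtain ⟨n, hn⟩ := (hlim.eventually_mem hWp).exists
    exact hxz _ (hWU hn)
  have hnhds : ∀ x, 𝓝 x = comap (Prod.mk x) 𝒲 := by
    intro x
    refine le_antisymm ?_ fun U hU => ?_
    · rw [← tendsto_iff_comap]
      intro U hU
      obtain ⟨⟨W, hW, hWU⟩, hd⟩ := hmem.1 hU
      by_cases hx : x ∈ K
      · have hcont : Continuous fun y => pair (x, y) :=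
          continuous_union_single.comp (Continuous.prodMk_right x)
        have hWx : W ∈ 𝓝 (pair (x, x)) := by
          simp only [hpair, union_single_self]
          exact nhds_le_nhdsSet (mem_image_of_mem _ hx) hW
        exact mem_of_superset (hcont.continuousAt hWx) fun y hy => hWU hy
      · have hx' : IsOpen ({x} : Set X) := by simpa [hK, nonIsolatedPoints] using hx
        exact mem_of_superset (x := {x}) (hx'.mem_nhds rfl) (singleton_subset_iff.2 (hd x))
    · obtain ⟨V, hVU, hV, hxV⟩ := mem_nhds_iff.1 hU
      -- if `{x, y}` lies in `plus V ∪ plus {x}ᶜ`, then `y ∈ V`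
      have hW : plus V ∪ plus {x}ᶜ ∈ 𝓝ˢ (single '' K) := by
        refine ((isOpen_plus hV).union (isOpen_plus isOpen_compl_singleton)).mem_nhdsSet.2 ?_
        rintro _ ⟨k, -, rfl⟩
        rcases eq_or_ne k x with rfl | hk
        · exact Or.inl (singleton_subset_iff.2 hxV)
        · exact Or.inr (singleton_subset_iff.2 hk)
      refine ⟨pair ⁻¹' (plus V ∪ plus {x}ᶜ) ∪ SetRel.id,
        hmem.2 ⟨⟨_, hW, subset_union_left⟩, fun x => Or.inr rfl⟩, ?_⟩
      rintro y ((hy | hy) | hy)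
      · exact hVU (hy (Or.inr rfl))
      · exact absurd rfl (hy (Or.inl rfl))
      · obtain rfl : x = y := hy
        exact hVU hxV
  let u : UniformSpace X :=
    { uniformity := 𝒲, symm := hsymm, comp := hcomp, nhds_eq_comap_uniformity := hnhds }
  have : (uniformity X).IsCountablyGenerated := inferInstanceAs 𝒲.IsCountablyGenerated
  exact UniformSpace.metrizableSpace

theorem metrizableSpace_and_isCompact
    (h : ∀ 𝒞 : Set (CL X), IsClosed 𝒞 → IsCountablyCompact 𝒞 → HasCountableBaseAt 𝒞) :
    MetrizableSpace X ∧ IsCompact (nonIsolatedPoints X) := by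
  have hfc : FirstCountableTopology (CL X) := ⟨fun A => by
    simpa only [nhdsSet_singleton] using
      (h {A} isClosed_singleton isCountablyCompact_singleton).isCountablyGenerated⟩
  have hcc := isCountablyCompact_nonIsolatedPoints (X := X)
    fun A hA => isCountablyGenerated_nhdsSet_of_isClosed hA
  have hX := metrizableSpace_of_isCountablyGenerated (h _
    (isClosed_image_single (isClosed_nonIsolatedPoints X))
    (hcc.image continuous_single)).isCountablyGenerated
  let := metrizableSpaceMetric X
  exact ⟨hX, hcc.isSeqCompact.isCompact⟩

end CL

/-! ### Metrizable spaces -/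

theorem hasPointCountableBase_of_metrizableSpace (Y : Type*) [TopologicalSpace Y]
    [MetrizableSpace Y] : HasPointCountableBase Y := by
  let := metrizableSpaceMetric Y
  have hpos : ∀ n : ℕ, 0 < 1 / ((n : ℝ) + 1) := fun n => Nat.one_div_pos_of_nat
  have hcov : ∀ n : ℕ, ⋃ c : Y, Metric.ball c (1 / ((n : ℝ) + 1)) = univ := fun n =>
    iUnion_eq_univ_iff.2 fun y => ⟨y, Metric.mem_ball_self (hpos n)⟩
  choose v hvo hvc hvlf hvs using fun n : ℕ =>
    precise_refinement (fun c : Y => Metric.ball c (1 / ((n : ℝ) + 1)))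
      (fun _ => Metric.isOpen_ball) (hcov n)
  refine ⟨⋃ n, range (v n), isTopologicalBasis_of_isOpen_of_nhds ?_ ?_, fun y => ?_⟩
  · simp only [mem_iUnion]
    rintro _ ⟨n, i, rfl⟩
    exact hvo n i
  · intro y U hy hU
    obtain ⟨ε, hε, hεU⟩ := Metric.isOpen_iff.1 hU y hy
    obtain ⟨n, hn⟩ := exists_nat_one_div_lt (half_pos hε)
    obtain ⟨i, hi⟩ := iUnion_eq_univ_iff.1 (hvc n) y
    refine ⟨v n i, mem_iUnion.2 ⟨n, i, rfl⟩, hi, fun z hz => hεU ?_⟩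
    have h1 := Metric.mem_ball.1 (hvs n i hi)
    have h2 := Metric.mem_ball.1 (hvs n i hz)
    rw [Metric.mem_ball]
    linarith [dist_triangle_right z y i]
  · refine (countable_iUnion fun n => ((hvlf n).point_finite y).countable.image (v n)).mono ?_
    rintro B ⟨hB, hyB⟩
    obtain ⟨n, i, rfl⟩ := mem_iUnion.1 hB
    exact mem_iUnion.2 ⟨n, i, hyB, rfl⟩

theorem quasiMetrizable_of_metrizableSpace (Y : Type*) [TopologicalSpace Y]
    [MetrizableSpace Y] : QuasiMetrizable Y := by
  let := metrizableSpaceMetric Y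
  have hball : ∀ (x : Y) (ε : ℝ), {y | dist x y < ε} = Metric.ball x ε := fun x ε => by
    ext y; simp [dist_comm]
  refine ⟨dist, ⟨fun _ _ => dist_nonneg, fun _ _ => dist_eq_zero, dist_triangle⟩,
    isTopologicalBasis_of_isOpen_of_nhds ?_ fun y U hy hU => ?_⟩
  · rintro _ ⟨x, ε, -, rfl⟩
    exact hball x ε ▸ Metric.isOpen_ball
  · obtain ⟨ε, hε, hεU⟩ := Metric.isOpen_iff.1 hU y hy
    exact ⟨_, ⟨y, ε, hε, rfl⟩, by simpa using hε, (hball y ε).trans_subset hεU⟩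

/-! ### Countably compact sets have countable bases -/

/-- A point-countable open cover of a countably compact set has a finite subcover. Otherwise there
is a sequence no two terms of which lie in a common member of the cover, since the members that
contain one of finitely many points are countably many; such a sequence has no cluster point. -/
theorem IsCountablyCompact.exists_finite_subcover_of_pointCountable {Y : Type*}
    [TopologicalSpace Y] {C : Set Y} (hC : IsCountablyCompact C) {𝒱 : Set (Set Y)}
    (hopen : ∀ V ∈ 𝒱, IsOpen V) (hcount : ∀ y, {V ∈ 𝒱 | y ∈ V}.Countable) (hcov : C ⊆ ⋃₀ 𝒱) :
    ∃ F ⊆ 𝒱, F.Finite ∧ C ⊆ ⋃₀ F := by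
  by_contra! hno
  obtain ⟨x, hxC, hx⟩ := exists_seq_of_forall_finset_exists (fun y => y ∈ C)
    (fun y z => ∀ V ∈ 𝒱, y ∈ V → z ∉ V) fun s _ => by
      by_contra! hs
      have hct : (⋃ y ∈ s, {V ∈ 𝒱 | y ∈ V}).Countable :=
        s.countable_toSet.biUnion fun y _ => hcount y
      have hsub : ⋃ y ∈ s, {V ∈ 𝒱 | y ∈ V} ⊆ 𝒱 := iUnion₂_subset fun y _ => sep_subset _ _
      obtain ⟨F, hF, hFfin, hFC⟩ := hC.elim_finite_subcover_image hct (U := id)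
        (fun V hV => hopen V (hsub hV)) fun z hz => by
          obtain ⟨y, hy, V, hV, hyV, hzV⟩ := hs z hz
          exact mem_iUnion₂.2 ⟨V, mem_iUnion₂.2 ⟨y, hy, hV, hyV⟩, hzV⟩
      exact hno F (hF.trans hsub) hFfin (by rwa [sUnion_eq_biUnion])
  obtain ⟨z, hz, hcl⟩ := hC.seq_clusterPt x (Eventually.of_forall hxC)
  obtain ⟨V, hV, hzV⟩ := hcov hz
  have hfr := hcl.frequently ((hopen V hV).mem_nhds hzV)
  obtain ⟨m, hm⟩ := hfr.exists
  obtain ⟨n, hn, hmn⟩ := (hfr.and_eventually (eventually_gt_atTop m)).exists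
  exact hx m n hmn V hV hm hn

/-- **Miščenko's lemma**: a point-countable family contains only countably many minimal finite
covers of a given set. -/
theorem countable_setOf_minimal_finite_cover {α : Type*} {C : Set α} {ℬ : Set (Set α)}
    (hcount : ∀ y, {B ∈ ℬ | y ∈ B}.Countable) :
    {F : Finset (Set α) | (F : Set (Set α)) ⊆ ℬ ∧ C ⊆ ⋃₀ F ∧
      ∀ G ⊂ F, ¬ C ⊆ ⋃₀ (G : Set (Set α))}.Countable := by
  classical
  set M := {F : Finset (Set α) | (F : Set (Set α)) ⊆ ℬ ∧ C ⊆ ⋃₀ F ∧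
      ∀ G ⊂ F, ¬ C ⊆ ⋃₀ (G : Set (Set α))}
  -- a minimal cover that properly contains `G` must have a member through a point missed by `G`, and
  -- only countably many members are available
  have key : ∀ (j : ℕ) (G : Finset (Set α)), {F ∈ M | G ⊆ F ∧ F.card ≤ G.card + j}.Countable := by
    intro j
    induction j with
    | zero =>
      refine fun G => (countable_singleton G).mono ?_
      rintro F ⟨-, hGF, hcard⟩
      exact (Finset.eq_of_subset_of_card_le hGF hcard).symm
    | succ j ih =>
      intro G
      by_cases hG : C ⊆ ⋃₀ (G : Set (Set α))
      · refine (countable_singleton G).mono ?_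
        rintro F ⟨hF, hGF, -⟩
        by_contra hne
        exact hF.2.2 G (hGF.ssubset_of_ne (Ne.symm hne)) hG
      · obtain ⟨x, hxC, hx⟩ := not_subset.1 hG
        refine ((hcount x).biUnion fun B _ => ih (insert B G)).mono ?_
        rintro F ⟨hF, hGF, hcard⟩
        obtain ⟨B, hBF, hxB⟩ := hF.2.1 hxC
        have hBG : B ∉ G := fun h => hx ⟨B, h, hxB⟩
        refine mem_iUnion₂.2 ⟨B, ⟨hF.1 hBF, hxB⟩, hF, Finset.insert_subset hBF hGF, ?_⟩
        rw [Finset.card_insert_of_notMem hBG]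
        omega
  refine (countable_iUnion fun j => key j ∅).mono fun F hF => ?_
  exact mem_iUnion.2 ⟨F.card, hF, Finset.empty_subset F, by simp⟩

theorem HasPointCountableBase.hasCountableBaseAt {Y : Type*} [TopologicalSpace Y]
    (h : HasPointCountableBase Y) {C : Set Y} (hC : IsCountablyCompact C) :
    HasCountableBaseAt C := by
  obtain ⟨ℬ, hbase, hcount⟩ := h
  have hMct := countable_setOf_minimal_finite_cover (C := C) hcount
  set M := {F : Finset (Set Y) | (F : Set (Set Y)) ⊆ ℬ ∧ C ⊆ ⋃₀ F ∧
      ∀ G ⊂ F, ¬ C ⊆ ⋃₀ (G : Set (Set Y))}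
  refine ⟨(fun F : Finset (Set Y) => ⋃₀ (F : Set (Set Y))) '' M, hMct.image _, ?_,
    fun U hU hCU => ?_⟩
  · rintro _ ⟨F, hF, rfl⟩
    exact ⟨isOpen_sUnion fun B hB => hbase.isOpen (hF.1 hB), hF.2.1⟩
  · obtain ⟨F, hFU, hFfin, hFC⟩ := hC.exists_finite_subcover_of_pointCountable
      (𝒱 := {B ∈ ℬ | B ⊆ U}) (fun B hB => hbase.isOpen hB.1)
      (fun y => (hcount y).mono fun B hB => show B ∈ {B ∈ ℬ | y ∈ B} from ⟨hB.1.1, hB.2⟩)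
      fun y hy => by
        obtain ⟨B, hB, hyB, hBU⟩ := hbase.exists_subset_of_mem_open (hCU hy) hU
        exact ⟨B, ⟨hB, hBU⟩, hyB⟩
    lift F to Finset (Set Y) using hFfin
    obtain ⟨G, hGF, hG⟩ := exists_minimal_le_of_wellFoundedLT
      (fun G : Finset (Set Y) => C ⊆ ⋃₀ (G : Set (Set Y))) F hFC
    have hGF' : ∀ B ∈ G, B ∈ ℬ ∧ B ⊆ U := fun B hB => hFU (hGF hB)
    exact ⟨_, ⟨G, ⟨fun B hB => (hGF' B hB).1, hG.1, fun G' hG' => hG.not_prop_of_lt hG'⟩, rfl⟩,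
      sUnion_subset fun B hB => (hGF' B hB).2⟩

theorem QuasiMetrizable.hasCountableBaseAt {Y : Type*} [TopologicalSpace Y]
    (h : QuasiMetrizable Y) {C : Set Y} (hC : IsCountablyCompact C) :
    HasCountableBaseAt C := by
  obtain ⟨d, hd, hbase⟩ := h
  have hopen : ∀ x ε, 0 < ε → IsOpen {y | d x y < ε} := fun x ε hε =>
    hbase.isOpen ⟨x, ε, hε, rfl⟩
  have hself : ∀ x, d x x = 0 := fun x => (hd.eq_zero_iff x x).2 rfl
  have hnhds : ∀ x, (𝓝 x).HasBasis (fun ε : ℝ => 0 < ε) fun ε => {y | d x y < ε} := by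
    refine fun x => ⟨fun U => ⟨fun hU => ?_, ?_⟩⟩
    · obtain ⟨_, ⟨c, ε, hε, rfl⟩, hx, hsub⟩ := hbase.mem_nhds_iff.1 hU
      refine ⟨ε - d c x, sub_pos.2 hx, fun y (hy : d x y < ε - d c x) => hsub ?_⟩
      exact (hd.triangle c x y).trans_lt (by linarith)
    · rintro ⟨ε, hε, hsub⟩
      exact mem_of_superset ((hopen x ε hε).mem_nhds (by simpa [hself] using hε)) hsub
  set W : ℕ → Set Y := fun n => ⋃ x ∈ C, {y | d x y < 1 / ((n : ℝ) + 1)}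
  have hpos : ∀ n : ℕ, 0 < 1 / ((n : ℝ) + 1) := fun n => Nat.one_div_pos_of_nat
  refine ⟨range W, countable_range W, ?_, fun U hU hCU => ?_⟩
  · rintro _ ⟨n, rfl⟩
    exact ⟨isOpen_biUnion fun x _ => hopen x _ (hpos n),
      fun x hx => mem_iUnion₂.2 ⟨x, hx, by simpa [hself] using hpos n⟩⟩
  · by_contra! hno
    have hch : ∀ n : ℕ, ∃ x ∈ C, ∃ y, d x y < 1 / ((n : ℝ) + 1) ∧ y ∉ U := fun n => by
      obtain ⟨y, hy, hyU⟩ := not_subset.1 (hno (W n) (mem_range_self n))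
      obtain ⟨x, hx, hxy⟩ := mem_iUnion₂.1 hy
      exact ⟨x, hx, y, hxy, hyU⟩
    choose x hxC y hxy hyU using hch
    obtain ⟨z, hz, hcl⟩ := hC.seq_clusterPt x (Eventually.of_forall hxC)
    obtain ⟨ε, hε, hεU⟩ := (hnhds z).mem_iff.1 (hU.mem_nhds (hCU hz))
    have h1 := hcl.frequently ((hnhds z).mem_of_mem (half_pos hε))
    have h2 : ∀ᶠ n : ℕ in atTop, 1 / ((n : ℝ) + 1) < ε / 2 :=
      tendsto_one_div_add_atTop_nhds_zero_nat.eventually_lt_const (half_pos hε)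
    obtain ⟨n, hn1, hn2⟩ := (h1.and_eventually h2).exists
    refine hyU n (hεU ?_)
    calc d z (y n) ≤ d z (x n) + d (x n) (y n) := hd.triangle _ _ _
      _ < ε / 2 + ε / 2 := add_lt_add hn1 ((hxy n).trans hn2)
      _ = ε := add_halves ε

/-! ### The Hausdorff distance and the locally finite topology -/

/-- If the set `K` of non-isolated points is compact, a compatible extended distance can be chosen
such that a point is at most as far from `K` as from any other point. If `K` is empty, the distance
from `K` is `∞`, and this distance takes only the values `0` and `∞`. -/
theorem exists_emetricSpace_infEDist_le_edist {X : Type*} [t : TopologicalSpace X]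
    [MetrizableSpace X] (hK : IsCompact (nonIsolatedPoints X)) :
    ∃ e : EMetricSpace X, e.toPseudoEMetricSpace.toUniformSpace.toTopologicalSpace = t ∧
      ∃ K : Set X, @IsCompact X t K ∧ ∀ x y, x ≠ y → Metric.infEDist x K ≤ edist x y := by
  classical
  let m := metrizableSpaceMetric X
  set K := nonIsolatedPoints X with hKdef
  let ρ : X → ℝ≥0∞ := fun x => Metric.infEDist x K
  let D : X → X → ℝ≥0∞ := fun x y => if x = y then 0 else max (edist x y) (max (ρ x) (ρ y))
  have hD : ∀ {x y}, x ≠ y → D x y = max (edist x y) (max (ρ x) (ρ y)) := fun h => if_neg h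
  have hDself : ∀ x, D x x = 0 := fun x => if_pos rfl
  have hle : ∀ x y, edist x y ≤ D x y := fun x y => by
    rcases eq_or_ne x y with rfl | h
    · simp
    · exact (le_max_left _ _).trans_eq (hD h).symm
  have hleK : ∀ x y, y ∈ K → D x y ≤ edist x y := fun x y hy => by
    rcases eq_or_ne x y with rfl | h
    · simp [hDself]
    · rw [hD h]
      have h0 : ρ y = 0 := Metric.infEDist_zero_of_mem hy
      exact max_le le_rfl (max_le (Metric.infEDist_le_edist_of_mem hy) (h0.trans_le zero_le))
  have hcomm : ∀ x y, D x y = D y x := fun x y => by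
    rcases eq_or_ne x y with rfl | h
    · rfl
    · rw [hD h, hD h.symm, edist_comm, max_comm (ρ x)]
  have htri : ∀ x y z, D x z ≤ D x y + D y z := fun x y z => by
    rcases eq_or_ne x y with rfl | hxy
    · simp [hDself]
    rcases eq_or_ne y z with rfl | hyz
    · simp [hDself]
    rcases eq_or_ne x z with rfl | hxz
    · simp [hDself]
    rw [hD hxz]
    refine max_le ((edist_triangle x y z).trans (add_le_add (hle _ _) (hle _ _))) (max_le ?_ ?_)
    · refine le_trans ?_ le_self_add
      rw [hD hxy]
      exact (le_max_left _ _).trans (le_max_right _ _)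
    · refine le_trans ?_ le_add_self
      rw [hD hyz]
      exact (le_max_right _ _).trans (le_max_right _ _)
  let e : EMetricSpace X :=
    { edist := D
      edist_self := hDself
      edist_comm := hcomm
      edist_triangle := htri
      eq_of_edist_eq_zero := fun {x y} h =>
        edist_eq_zero.1 (le_antisymm ((hle x y).trans_eq h) zero_le) }
  refine ⟨e, TopologicalSpace.ext_nhds fun x => ?_, K, hK, fun x y hxy => ?_⟩
  · ext s
    have h1 := @EMetric.mem_nhds_iff X e.toPseudoEMetricSpace x s
    have h2 := @EMetric.mem_nhds_iff X m.toPseudoMetricSpace.toPseudoEMetricSpace x s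
    refine (h1.trans ?_).trans h2.symm
    constructor
    · rintro ⟨ε, hε, hs⟩
      by_cases hx : x ∈ K
      · exact ⟨ε, hε, fun y hy => hs ((hleK y x hx).trans_lt hy)⟩
      · have hx' : IsOpen ({x} : Set X) := by simpa [hKdef, nonIsolatedPoints] using hx
        obtain ⟨δ, hδ, hδx⟩ := h2.1 (mem_of_superset (hx'.mem_nhds rfl)
          (singleton_subset_iff.2 (hs (show D x x < ε from (hDself x).trans_lt hε))))
        exact ⟨δ, hδ, hδx⟩
    · rintro ⟨ε, hε, hs⟩
      exact ⟨ε, hε, fun y hy => hs ((hle y x).trans_lt hy)⟩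
  · have hρ : @Metric.infEDist X e.toPseudoEMetricSpace x K ≤ ρ x :=
      (@Metric.le_infEDist X m.toPseudoMetricSpace.toPseudoEMetricSpace x K _).2 fun k hk =>
        (@Metric.infEDist_le_edist_of_mem X e.toPseudoEMetricSpace x k K hk).trans (hleK x k hk)
    refine hρ.trans ?_
    change ρ x ≤ D x y
    rw [hD hxy]
    exact (le_max_left _ _).trans (le_max_right _ _)

namespace CL

section Hausdorff

variable {X : Type*} [EMetricSpace X]

/-- The inclusion of the hyperspace `CL X` in the space of all closed subsets of `X`, which carries
the Hausdorff distance. -/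
def toCloseds (A : CL X) : Closeds X :=
  ⟨A.1, A.2.2⟩

/-- Hausdorff balls are neighbourhoods in the locally finite topology, for any distance: a locally
finite cover of `X` by small open sets bounds the distance of points of `A` from `B`, and a set
`plus V` bounds the distance of points of `B` from `A`. -/
theorem setOf_hausdorffEDist_lt_mem_nhds (A : CL X) {ε : ℝ≥0∞} (hε : 0 < ε) :
    {B : CL X | Metric.hausdorffEDist B.1 A.1 < ε} ∈ 𝓝 A := by
  obtain ⟨δ, hδ, hδε⟩ := exists_between hε
  have hδ2 : 0 < δ / 2 := ENNReal.half_pos hδ.ne'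
  obtain ⟨v, hvo, hvc, hvlf, hvs⟩ := precise_refinement (fun c : X => Metric.eball c (δ / 2))
    (fun _ => Metric.isOpen_eball)
    (iUnion_eq_univ_iff.2 fun y => ⟨y, Metric.mem_eball_self hδ2⟩)
  have hminus : minus {U ∈ range v | (A.1 ∩ U).Nonempty} ∈ 𝓝 A := by
    refine (isOpen_minus ?_ ?_).mem_nhds ?_
    · rintro _ ⟨⟨i, rfl⟩, -⟩
      exact hvo i
    · exact hvlf.on_range.comp_injective (inclusion_injective (sep_subset _ _))
    · rintro U ⟨-, hU⟩
      exact hU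
  have hV : IsOpen {x : X | Metric.infEDist x A.1 < δ} :=
    isOpen_lt Metric.continuous_infEDist continuous_const
  have hplus : plus {x : X | Metric.infEDist x A.1 < δ} ∈ 𝓝 A :=
    (isOpen_plus hV).mem_nhds fun x hx => (Metric.infEDist_zero_of_mem hx).trans_lt hδ
  filter_upwards [hminus, hplus] with B hB1 hB2
  refine lt_of_le_of_lt (Metric.hausdorffEDist_le_of_infEDist (fun b hb => (hB2 hb).le)
    fun a ha => ?_) hδε
  obtain ⟨i, hi⟩ := iUnion_eq_univ_iff.1 hvc a
  obtain ⟨b, hb, hbi⟩ := hB1 (v i) ⟨mem_range_self i, a, ha, hi⟩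
  calc Metric.infEDist a B.1 ≤ edist a b := Metric.infEDist_le_edist_of_mem hb
    _ ≤ edist a i + edist b i := edist_triangle_right a b i
    _ ≤ δ / 2 + δ / 2 := add_le_add (hvs i hi).le (hvs i hbi).le
    _ = δ := ENNReal.add_halves δ

/-- A Lebesgue number of the cover of `K` by `V` and `Aᶜ` gives the radius: a point of `B` near, but
different from, a point `a ∈ A` lies, like `a`, near a point of `K`. -/
theorem exists_pos_setOf_hausdorffEDist_lt_subset_plus {K : Set X} (hK : IsCompact K)
    (hsep : ∀ x y : X, x ≠ y → Metric.infEDist x K ≤ edist x y) {A : CL X} {V : Set X}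
    (hV : IsOpen V) (hAV : A.1 ⊆ V) :
    ∃ ε > 0, {B : CL X | Metric.hausdorffEDist B.1 A.1 < ε} ⊆ plus V := by
  obtain ⟨δ, hδ, hball⟩ := lebesgue_number_lemma_of_emetric (c := fun b : Bool => cond b V A.1ᶜ) hK
    (by rintro (_ | _); exacts [A.2.2.isOpen_compl, hV])
    (fun x _ => by
      by_cases hx : x ∈ A.1
      · exact mem_iUnion.2 ⟨true, hAV hx⟩
      · exact mem_iUnion.2 ⟨false, hx⟩)
  have hδ2 : 0 < δ / 2 := ENNReal.half_pos hδ.ne'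
  refine ⟨δ / 2, hδ2, fun B hB b hb => ?_⟩
  obtain ⟨a, ha, hba⟩ := Metric.exists_edist_lt_of_hausdorffEDist_lt hb hB
  rcases eq_or_ne a b with rfl | hne
  · exact hAV ha
  obtain ⟨k, hk, hak⟩ := Metric.infEDist_lt_iff.1
    ((hsep a b hne).trans_lt (edist_comm a b ▸ hba))
  have hbk : edist b k < δ := calc
    edist b k ≤ edist b a + edist a k := edist_triangle _ _ _
    _ < δ / 2 + δ / 2 := ENNReal.add_lt_add hba hak
    _ = δ := ENNReal.add_halves δ
  obtain ⟨_ | _, hi⟩ := hball k hk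
  · exact absurd ha (hi (show edist a k < δ from hak.trans_le ENNReal.half_le_self))
  · exact hi hbk

/-- Finitely many members of `𝒰` come near `K`, and each of them is met by all sets at small
Hausdorff distance from `A`. The other members meet `A` in points far from `K`, and these belong to
every set at small Hausdorff distance from `A`. -/
theorem exists_pos_setOf_hausdorffEDist_lt_subset_minus {K : Set X} (hK : IsCompact K)
    (hsep : ∀ x y : X, x ≠ y → Metric.infEDist x K ≤ edist x y) {A : CL X} {𝒰 : Set (Set X)}
    (hU : ∀ U ∈ 𝒰, IsOpen U) (hlf : LocallyFinite (fun U : 𝒰 => (U : Set X)))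
    (hA : A ∈ minus 𝒰) :
    ∃ ε > 0, {B : CL X | Metric.hausdorffEDist B.1 A.1 < ε} ⊆ minus 𝒰 := by
  -- only finitely many members of `𝒰` meet a neighbourhood of `K`
  obtain ⟨N, hN, hfin⟩ : ∃ N ∈ 𝓝ˢ K, {U : 𝒰 | ((U : Set X) ∩ N).Nonempty}.Finite := by
    choose O hO hOfin using hlf
    obtain ⟨s, -, hs⟩ := hK.elim_nhds_subcover_nhdsSet fun x _ => hO x
    refine ⟨⋃ x ∈ s, O x, hs, (s.finite_toSet.biUnion fun x _ => hOfin x).subset ?_⟩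
    rintro U ⟨y, hyU, hy⟩
    obtain ⟨x, hx, hyx⟩ := mem_iUnion₂.1 hy
    exact mem_iUnion₂.2 ⟨x, hx, y, hyU, hyx⟩
  obtain ⟨η, hη, hηN⟩ : ∃ η > 0, {x | Metric.infEDist x K < η} ⊆ N := by
    obtain ⟨W, hW, hKW, hWN⟩ := mem_nhdsSet_iff_exists.1 hN
    obtain ⟨δ, hδ, hδW⟩ := hK.exists_thickening_subset_open hW hKW
    exact ⟨ENNReal.ofReal δ, ENNReal.ofReal_pos.2 hδ, hδW.trans hWN⟩
  choose a haA haU using fun U : 𝒰 => hA U U.2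
  have hr : ∀ U : 𝒰, ∃ r > 0, Metric.eball (a U) r ⊆ (U : Set X) := fun U =>
    EMetric.mem_nhds_iff.1 ((hU U U.2).mem_nhds (haU U))
  choose r hr hrU using hr
  have hpos : 0 < min η (hfin.toFinset.inf r) :=
    lt_min hη ((Finset.lt_inf_iff (by simp)).2 fun U _ => hr U)
  refine ⟨_, hpos, fun B hB U hUU => ?_⟩
  lift U to 𝒰 using hUU
  obtain ⟨b, hb, hab⟩ := Metric.exists_edist_lt_of_hausdorffEDist_lt (haA U)
    ((Metric.hausdorffEDist_comm).trans_lt hB)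
  by_cases hUN : ((U : Set X) ∩ N).Nonempty
  · refine ⟨b, hb, hrU U ?_⟩
    rw [Metric.mem_eball']
    exact hab.trans_le ((min_le_right _ _).trans
      (Finset.inf_le (f := r) (b := U) (hfin.mem_toFinset.2 hUN)))
  · obtain rfl : a U = b := by
      by_contra hne
      exact hUN ⟨a U, haU U, hηN ((hsep _ _ hne).trans_lt (hab.trans_le (min_le_left _ _)))⟩
    exact ⟨a U, hb, haU U⟩

theorem isInducing_toCloseds {K : Set X} (hK : IsCompact K)
    (hsep : ∀ x y : X, x ≠ y → Metric.infEDist x K ≤ edist x y) :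
    IsInducing (toCloseds : CL X → Closeds X) := by
  refine isInducing_iff_nhds.2 fun A => le_antisymm ?_ ?_
  · rw [← tendsto_iff_comap, Metric.nhds_basis_eball.tendsto_right_iff]
    exact fun ε hε => setOf_hausdorffEDist_lt_mem_nhds A hε
  · rw [nhds_generateFrom]
    refine le_iInf₂ fun S hS => le_principal_iff.2 ?_
    obtain ⟨hAS, ⟨V, hV, rfl⟩ | ⟨𝒰, hU, hlf, rfl⟩⟩ := hS
    · obtain ⟨ε, hε, hsub⟩ := exists_pos_setOf_hausdorffEDist_lt_subset_plus hK hsep hV hAS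
      exact mem_of_superset ((Metric.nhds_basis_eball.comap _).mem_of_mem hε) hsub
    · obtain ⟨ε, hε, hsub⟩ := exists_pos_setOf_hausdorffEDist_lt_subset_minus hK hsep hU hlf hAS
      exact mem_of_superset ((Metric.nhds_basis_eball.comap _).mem_of_mem hε) hsub

end Hausdorff

theorem metrizableSpace_of_isCompact {X : Type*} [t : TopologicalSpace X] [MetrizableSpace X]
    (hK : IsCompact (nonIsolatedPoints X)) : MetrizableSpace (CL X) := by
  obtain ⟨e, rfl, K, hK, hsep⟩ := exists_emetricSpace_infEDist_le_edist hK
  have hemb : IsEmbedding (toCloseds : CL X → Closeds X) :=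
    ⟨isInducing_toCloseds hK hsep,
      fun A B h => Subtype.ext (congrArg (fun C : Closeds X => (C : Set X)) h)⟩
  exact hemb.metrizableSpace

end CL

/-! ### The equivalence -/

theorem corollary2p11 (X : Type*) [TopologicalSpace X] [T2Space X] :
    List.TFAE [
      MetrizableSpace (CL X),
      HasPointCountableBase (CL X),
      QuasiMetrizable (CL X),
      ∀ 𝒞 : Set (CL X), IsClosed 𝒞 → IsCountablyCompact 𝒞 → HasCountableBaseAt 𝒞,
      MetrizableSpace X ∧ IsCompact (nonIsolatedPoints X)] := by
  tfae_have 1 → 2 := fun _ => hasPointCountableBase_of_metrizableSpace (CL X)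
  tfae_have 1 → 3 := fun _ => quasiMetrizable_of_metrizableSpace (CL X)
  tfae_have 2 → 4 := fun h _ _ h𝒞 => h.hasCountableBaseAt h𝒞
  tfae_have 3 → 4 := fun h _ _ h𝒞 => h.hasCountableBaseAt h𝒞
  tfae_have 4 → 5 := CL.metrizableSpace_and_isCompact
  tfae_have 5 → 1 := fun ⟨_, hK⟩ => CL.metrizableSpace_of_isCompact hK
  tfae_finish
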